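/- A $\sigma$-finite measure space $(S,\mathcal S,\mu)$ has the approximation-by-averaging property if for every $n\in\mathbb N$ there is a finite or countable family $\mathfrak B_n$ of pairwise disjoint measurable subsets of $S$ of positive, finite measure such that, for every real Banach space $E$, every $p\in[1,\infty)$ and every $f\in L^p(S;E)$, the averages $f_n:=\sum_{B\in\mathfrak B_n}\mathbf 1_B\,\frac1{\mu(B)}\int_B f\,d\mu$ converge to $f$ in $L^p(S;E)$ as $n\to\infty$. For $q\in[1,\infty)$, the Khintchine constant $B_q\in(0,\infty)$ is the smallest positive constant such that $\bigl\|\sum_{j=1}^n r_ja_j\bigr\|_{L^q}\le B_q\bigl(\sum_{j=1}^n a_j^2\bigr)^{1/2}$ for every family $(r_j)_{j\in\mathbb N}$ of independent random variables with values in $\{-1,1\}$, each taken with probability $\frac12$, and all $n\in\mathbb{N}$, $a_1,\dots,a_n\in\mathbb R$. Let $(S,\mathcal S,\mu)$ be a $\sigma$-finite measure space with the approximation-by-averaging property, let $(\Omega,\mathcal A,\mathbb P)$ be a probability space, let $1\le p\le q<\infty$, $\bar q:=\min\{q,2\}$, and $M\in\mathbb N$, $M\ge1$. Let $\eta_1,\dots,\eta_M$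 be independent and identically distributed $L^p(S)$-valued random variables in $L^q(\Omega;L^p(S))\cap L^p(S;L^q(\Omega))$ with $\mathbb E[\eta_1]=0$. Here $\eta_j\in L^p(S;L^q(\Omega))$ means that for a measurable function $\widetilde\eta_j\colon S\times\Omega\to\mathbb R$ with $\eta_j(\omega)=\widetilde\eta_j(\cdot,\omega)$ in $L^p(S)$ for almost all $\omega$, the map $s\mapsto\widetilde\eta_j(s,\cdot)$ belongs to $L^p(S;L^q(\Omega))$, and $\|\eta_j\|_{L^p(S;L^q(\Omega))}$ is the norm of that map. Then $$\Bigl\|\frac1M\sum_{j=1}^M\eta_j\Bigr\|_{L^q(\Omega;L^p(S))}\le 2\,B_q\,M^{-(1-1/\bar q)}\,\|\eta_1\|_{L^p(S;L^q(\Omega))}.$$ -/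

import Mathlib

open MeasureTheory ProbabilityTheory Filter Topology
open scoped ENNReal

universe u v w

noncomputable section

/-- The average of `f` with respect to a family `𝓑` of sets: on each `A ∈ 𝓑` it is the constant
`μ(A)⁻¹ ∫_A f dμ`, and it vanishes outside `⋃ 𝓑`. For a pairwise disjoint family, at most one
term of the sum is nonzero at each point. -/
def averageOver {S : Type u} [MeasurableSpace S] (μ : Measure S) {E : Type w}
    [NormedAddCommGroup E] [NormedSpace ℝ E] (𝓑 : Set (Set S)) (f : S → E) : S → E :=
  fun s => ∑' A : 𝓑, (A : Set S).indicator (fun _ => (μ.real A)⁻¹ • ∫ x in (A : Set S), f x ∂μ) s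

/-- The approximation-by-averaging property of a measure space: there are countable families
`𝓑 n` of pairwise disjoint measurable sets of positive finite measure such that for every real
Banach space `E`, every `p ∈ [1, ∞)` and every `f ∈ L^p(S; E)` the averages of `f` over `𝓑 n`
converge to `f` in `L^p(S; E)`. -/
def ApproximationByAveraging {S : Type u} [MeasurableSpace S] (μ : Measure S) : Prop :=
  ∃ 𝓑 : ℕ → Set (Set S),
    (∀ n, (𝓑 n).Countable ∧ (𝓑 n).PairwiseDisjoint id ∧
      ∀ A ∈ 𝓑 n, MeasurableSet A ∧ 0 < μ A ∧ μ A < ∞) ∧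
    ∀ (E : Type w) [NormedAddCommGroup E] [NormedSpace ℝ E] [CompleteSpace E]
      (p : ℝ≥0∞), 1 ≤ p → p ≠ ∞ → ∀ f : S → E, MemLp f p μ →
        Tendsto (fun n => eLpNorm (f - averageOver μ (𝓑 n) f) p μ) atTop (𝓝 0)

/-- A Rademacher family: independent random variables with values in `{-1, 1}`, each value being
taken with probability `1/2`. -/
structure IsRademacherFamily {Ω : Type v} [MeasurableSpace Ω] (P : Measure Ω)
    (r : ℕ → Ω → ℝ) : Prop where
  measurable : ∀ j, Measurable (r j)
  mem : ∀ j ω, r j ω = -1 ∨ r j ω = 1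
  indep : iIndepFun r P
  prob_neg_one : ∀ j, P {ω | r j ω = -1} = 1 / 2
  prob_one : ∀ j, P {ω | r j ω = 1} = 1 / 2

/-- The (upper) Khintchine constant `B_q`: the smallest `B > 0` such that
`‖∑ r_j a_j‖_{L^q} ≤ B (∑ a_j²)^{1/2}` for every Rademacher family `(r_j)` on a probability space
and every finite real sequence `(a_j)`. (The law of a Rademacher family is unique, so neither the
universe of the probability space nor its completeness affects the value.) -/
def khintchineConst (q : ℝ≥0∞) : ℝ :=
  sInf {B : ℝ | 0 < B ∧ ∀ (Ω : Type) [MeasurableSpace Ω] (P : Measure Ω) [IsProbabilityMeasure P]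
    (r : ℕ → Ω → ℝ), IsRademacherFamily P r → ∀ (n : ℕ) (a : ℕ → ℝ),
      eLpNorm (fun ω => ∑ j ∈ Finset.range n, r j ω * a j) q P ≤
        ENNReal.ofReal (B * √(∑ j ∈ Finset.range n, a j ^ 2))}

/-- `η : Ω → L^p(S)` and `F : S → L^q(Ω)` come from one function: there is a (jointly) measurable
`f : S × Ω → ℝ` with `η(ω) = f(·, ω)` in `L^p(S)` for almost all `ω` and `F(s) = f(s, ·)` in
`L^q(Ω)` for almost all `s`. Thus an element of `L^q(Ω; L^p(S)) ∩ L^p(S; L^q(Ω))` is such a pair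
with `η ∈ L^q(Ω; L^p(S))` and `F ∈ L^p(S; L^q(Ω))`; `F` is determined by `η` almost everywhere. -/
def HaveCommonRepresentative {S : Type u} [MeasurableSpace S] {μ : Measure S}
    {Ω : Type v} [MeasurableSpace Ω] {P : Measure Ω} {p q : ℝ≥0∞}
    (η : Ω → Lp ℝ p μ) (F : S → Lp ℝ q P) : Prop :=
  ∃ f : S × Ω → ℝ, Measurable f ∧
    (∀ᵐ ω ∂P, (η ω : S → ℝ) =ᵐ[μ] fun s => f (s, ω)) ∧
    (∀ᵐ s ∂μ, (F s : Ω → ℝ) =ᵐ[P] fun ω => f (s, ω))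

end

/-!
The sum is symmetrized in `L^p(S)` itself. For fixed signs `ε j`, the sum of the `η j` over the
indices with a given sign is, up to that sign, a conditional expectation of `∑ ε j • η j`. Hence
`‖∑ η j‖ ≤ 2 ‖∑ ε j • η j‖` in `L^q(Ω; L^p(S))`, and averaging over a Rademacher family `r` replaces
`ε` by `r`. Since `p ≤ q`, Minkowski's integral inequality bounds the norm in `L^q(L^p(S))` by the
norm in `L^p(S; L^q)`, where Khintchine's inequality applies for each `s` separately and yields the
square function `(∑ |η j (s)|²)^{1/2}`. Its `L^q`-norm is at most the `ℓ^{min q 2}`-sum of the norms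
`‖η j (s)‖_{L^q(Ω)}`. These agree for almost every `s`, because the integral of
`‖η j (s)‖_{L^q(Ω)}^q` over a measurable set is an expectation of a Borel function of `η j`.
-/

section MixedNorms

variable {α β ε : Type*} [MeasurableSpace α] [MeasurableSpace β] {μ : Measure α} {ν : Measure β}

lemma eLpNorm_rpow_toReal [ENorm ε] {q : ℝ≥0∞} (hq0 : q ≠ 0) (hq : q ≠ ∞) (f : α → ε) :
    eLpNorm f q μ ^ q.toReal = ∫⁻ x, ‖f x‖ₑ ^ q.toReal ∂μ := by
  rw [eLpNorm_eq_lintegral_rpow_enorm_toReal hq0 hq, one_div,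
    ENNReal.rpow_inv_rpow (ENNReal.toReal_pos hq0 hq).ne']

lemma eLpNorm_prod [TopologicalSpace ε] [ContinuousENorm ε] [SFinite ν] {q : ℝ≥0∞} (hq : q ≠ ∞)
    {f : α × β → ε} (hf : AEStronglyMeasurable f (μ.prod ν)) :
    eLpNorm f q (μ.prod ν) = eLpNorm (fun x => eLpNorm (fun y => f (x, y)) q ν) q μ := by
  rcases eq_or_ne q 0 with rfl | hq0
  · simp only [eLpNorm_exponent_zero]
  simp only [eLpNorm_eq_lintegral_rpow_enorm_toReal hq0 hq (μ := μ.prod ν),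
    eLpNorm_eq_lintegral_rpow_enorm_toReal hq0 hq (μ := μ), enorm_eq_self,
    eLpNorm_rpow_toReal hq0 hq]
  rw [lintegral_prod _ (hf.enorm.pow_const _)]

lemma eLpNorm_prod_symm [TopologicalSpace ε] [ContinuousENorm ε] [SFinite μ] [SFinite ν]
    {q : ℝ≥0∞} (hq : q ≠ ∞) {f : α × β → ε} (hf : AEStronglyMeasurable f (μ.prod ν)) :
    eLpNorm f q (μ.prod ν) = eLpNorm (fun y => eLpNorm (fun x => f (x, y)) q μ) q ν := by
  have hswap : MeasurePreserving Prod.swap (ν.prod μ) (μ.prod ν) := Measure.measurePreserving_swap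
  rw [← eLpNorm_comp_measurePreserving hf hswap,
    eLpNorm_prod hq (hf.comp_measurePreserving hswap)]
  rfl

lemma measurable_eLpNorm_prodMk_left [TopologicalSpace ε] [ContinuousENorm ε] [SFinite ν]
    {f : α × β → ε} (hf : StronglyMeasurable f) {q : ℝ≥0∞} (hq : q ≠ ∞) :
    Measurable fun x => eLpNorm (fun y => f (x, y)) q ν := by
  rcases eq_or_ne q 0 with rfl | hq0
  · simp
  simp only [eLpNorm_eq_lintegral_rpow_enorm_toReal hq0 hq]
  exact (hf.enorm.pow_const _).lintegral_prod_right'.pow_const _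

lemma lintegral_rpow_rpow_inv_le_of_le_lintegral [SFinite μ] [SFinite ν] {r : ℝ} (hr : 1 ≤ r)
    {g : α × β → ℝ≥0∞} (hg : Measurable g) {h : β → ℝ≥0∞} (hh : Measurable h)
    (hfin : ∫⁻ y, h y ^ r ∂ν ≠ ∞) (hle : ∀ y, h y ≤ ∫⁻ x, g (x, y) ∂μ) :
    (∫⁻ y, h y ^ r ∂ν) ^ r⁻¹ ≤ ∫⁻ x, (∫⁻ y, g (x, y) ^ r ∂ν) ^ r⁻¹ ∂μ := by
  have hr0 : 0 < r := one_pos.trans_le hr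
  have hr1 : 0 ≤ 1 - r⁻¹ := sub_nonneg.2 (inv_le_one_of_one_le₀ hr)
  set I := ∫⁻ y, h y ^ r ∂ν with hI
  rcases eq_or_ne I 0 with h0 | h0
  · simp only [h0, ENNReal.zero_rpow_of_pos (inv_pos.2 hr0), zero_le]
  have holder (x : α) : ∫⁻ y, g (x, y) * h y ^ (r - 1) ∂ν ≤
      (∫⁻ y, g (x, y) ^ r ∂ν) ^ r⁻¹ * I ^ (1 - r⁻¹) := by
    have hgx : Measurable fun y => g (x, y) := hg.comp measurable_prodMk_left
    convert ENNReal.lintegral_mul_norm_pow_le (hgx.pow_const r).aemeasurable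
      (hh.pow_const r).aemeasurable (inv_nonneg.2 hr0.le) hr1 (by ring) using 4 with y
    · rw [ENNReal.rpow_rpow_inv hr0.ne']
    · rw [← ENNReal.rpow_mul, mul_sub, mul_one, mul_inv_cancel₀ hr0.ne']
  have hpow : I ^ r⁻¹ * I ^ (1 - r⁻¹) ≤
      (∫⁻ x, (∫⁻ y, g (x, y) ^ r ∂ν) ^ r⁻¹ ∂μ) * I ^ (1 - r⁻¹) :=
    calc I ^ r⁻¹ * I ^ (1 - r⁻¹) = ∫⁻ y, h y * h y ^ (r - 1) ∂ν := by
          rw [← ENNReal.rpow_add _ _ h0 hfin, add_sub_cancel, ENNReal.rpow_one, hI]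
          refine lintegral_congr fun y => ?_
          nth_rewrite 2 [← ENNReal.rpow_one (h y)]
          rw [← ENNReal.rpow_add_of_nonneg _ _ zero_le_one (sub_nonneg.2 hr), add_sub_cancel]
      _ ≤ ∫⁻ y, (∫⁻ x, g (x, y) ∂μ) * h y ^ (r - 1) ∂ν := by gcongr with y; exact hle y
      _ = ∫⁻ y, ∫⁻ x, g (x, y) * h y ^ (r - 1) ∂μ ∂ν :=
          lintegral_congr fun y => (lintegral_mul_const _ (hg.comp measurable_prodMk_right)).symm
      _ = ∫⁻ x, ∫⁻ y, g (x, y) * h y ^ (r - 1) ∂ν ∂μ :=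
          (lintegral_lintegral_swap (f := fun x y => g (x, y) * h y ^ (r - 1))
            (by fun_prop)).symm
      _ ≤ ∫⁻ x, (∫⁻ y, g (x, y) ^ r ∂ν) ^ r⁻¹ * I ^ (1 - r⁻¹) ∂μ := lintegral_mono holder
      _ = (∫⁻ x, (∫⁻ y, g (x, y) ^ r ∂ν) ^ r⁻¹ ∂μ) * I ^ (1 - r⁻¹) :=
          lintegral_mul_const _ ((hg.pow_const r).lintegral_prod_right'.pow_const _)
  exact (ENNReal.mul_le_mul_iff_left (by simp [ENNReal.rpow_eq_zero_iff, h0, hfin])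
    (ENNReal.rpow_ne_top_of_nonneg hr1 hfin)).1 hpow

/-- Minkowski's integral inequality. Hölder's inequality only bounds a finite left-hand side, whence
the approximation of the inner integral from below. -/
theorem lintegral_lintegral_rpow_rpow_inv_le [SFinite μ] [SigmaFinite ν] {r : ℝ} (hr : 1 ≤ r)
    {g : α × β → ℝ≥0∞} (hg : Measurable g) :
    (∫⁻ y, (∫⁻ x, g (x, y) ∂μ) ^ r ∂ν) ^ r⁻¹ ≤ ∫⁻ x, (∫⁻ y, g (x, y) ^ r ∂ν) ^ r⁻¹ ∂μ := by
  have hr0 : 0 < r := one_pos.trans_le hr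
  rw [ENNReal.rpow_inv_le_iff hr0]
  refine le_of_forall_lt fun L hL => ?_
  rw [lintegral_eq_nnreal] at hL
  obtain ⟨φ, hφ⟩ := lt_iSup_iff.1 hL
  obtain ⟨hφle, hφ⟩ := lt_iSup_iff.1 hφ
  rw [← SimpleFunc.lintegral_eq_lintegral] at hφ
  simp only [SimpleFunc.coe_map, Function.comp_apply] at hφ
  obtain ⟨ψ, hψφ, hψfin, hψ⟩ := SimpleFunc.exists_lt_lintegral_simpleFunc_of_lt_lintegral hφ
  have hpow (y : β) : ((ψ y : ℝ≥0∞) ^ r⁻¹) ^ r = ψ y := ENNReal.rpow_inv_rpow hr0.ne' _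
  have h := lintegral_rpow_rpow_inv_le_of_le_lintegral (ν := ν) hr hg
    (h := fun y => (ψ y : ℝ≥0∞) ^ r⁻¹) (by fun_prop) (by simpa only [hpow] using hψfin.ne)
    fun y => (ENNReal.rpow_inv_le_iff hr0).2
      ((ENNReal.coe_le_coe.2 (hψφ y)).trans (hφle y))
  simp only [hpow] at h
  exact hψ.trans_le ((ENNReal.rpow_inv_le_iff hr0).1 h)

theorem eLpNorm_eLpNorm_le [TopologicalSpace ε] [ContinuousENorm ε] [SFinite μ] [SigmaFinite ν]
    {p q : ℝ≥0∞} (hpq : p ≤ q) (hq : q ≠ ∞) {f : α × β → ε} (hf : StronglyMeasurable f) :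
    eLpNorm (fun y => eLpNorm (fun x => f (x, y)) p μ) q ν ≤
      eLpNorm (fun x => eLpNorm (fun y => f (x, y)) q ν) p μ := by
  rcases eq_or_ne p 0 with rfl | hp0
  · simp
  have hp : p ≠ ∞ := ne_top_of_le_ne_top hq hpq
  have hq0 : q ≠ 0 := (hp0.bot_lt.trans_le hpq).ne'
  have hP : 0 < p.toReal := ENNReal.toReal_pos hp0 hp
  have hr : 1 ≤ q.toReal / p.toReal := (one_le_div hP).2 (ENNReal.toReal_mono hq hpq)
  have minkowski := lintegral_lintegral_rpow_rpow_inv_le (μ := μ) (ν := ν) hr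
    (hf.enorm.pow_const p.toReal)
  have hexp : q.toReal * (q.toReal / p.toReal)⁻¹ = p.toReal := by
    rw [inv_div, mul_div_cancel₀ _ (ENNReal.toReal_pos hq0 hq).ne']
  simp only [← eLpNorm_rpow_toReal hp0 hp (fun x => f (x, _)), ← ENNReal.rpow_mul,
    mul_div_cancel₀ _ hP.ne', ← eLpNorm_rpow_toReal hq0 hq (fun y => f (_, y)), hexp] at minkowski
  rw [← ENNReal.rpow_le_rpow_iff hP, eLpNorm_rpow_toReal hp0 hp]
  simp only [enorm_eq_self]
  refine le_of_eq_of_le ?_ minkowski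
  rw [eLpNorm_eq_lintegral_rpow_enorm_toReal hq0 hq, ← ENNReal.rpow_mul, inv_div,
    one_div_mul_eq_div]
  simp only [enorm_eq_self]

end MixedNorms

/-- `f : S × Ω → E` is a strongly measurable function of two variables with `η ω = f(·, ω)` in
`L^p(S; E)` for almost all `ω`. It gives a meaning to the values `η ω s` of an `L^p`-valued random
variable as a function of `ω`. -/
structure IsJointRepresentative {S Ω E : Type*} [MeasurableSpace S] {μ : Measure S}
    [MeasurableSpace Ω] [NormedAddCommGroup E] {p : ℝ≥0∞} (P : Measure Ω) (f : S × Ω → E)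
    (η : Ω → Lp E p μ) : Prop where
  stronglyMeasurable : StronglyMeasurable f
  ae_eq : ∀ᵐ ω ∂P, η ω =ᵐ[μ] fun s => f (s, ω)

namespace IsJointRepresentative

variable {S Ω Ω' E : Type*} [MeasurableSpace S] {μ : Measure S} [MeasurableSpace Ω]
  {P : Measure Ω} [MeasurableSpace Ω'] {P' : Measure Ω'} [NormedAddCommGroup E] {p q : ℝ≥0∞}
  {f : S × Ω → E} {η : Ω → Lp E p μ}

lemma comp (hf : IsJointRepresentative P f η) {g : Ω' → Ω}
    (hg : Measure.QuasiMeasurePreserving g P' P) :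
    IsJointRepresentative P' (fun z => f (z.1, g z.2)) (fun ω => η (g ω)) where
  stronglyMeasurable := hf.stronglyMeasurable.comp_measurable
    (measurable_fst.prodMk (hg.measurable.comp measurable_snd))
  ae_eq := hg.ae hf.ae_eq

lemma smul [NormedSpace ℝ E] (hf : IsJointRepresentative P f η) {c : Ω → ℝ} (hc : Measurable c) :
    IsJointRepresentative P (fun z => c z.2 • f z) (fun ω => c ω • η ω) where
  stronglyMeasurable := (hc.comp measurable_snd).stronglyMeasurable.smul hf.stronglyMeasurable
  ae_eq := by
    filter_upwards [hf.ae_eq] with ω hω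
    filter_upwards [Lp.coeFn_smul (c ω) (η ω), hω] with s hsmul hs
    rw [hsmul, Pi.smul_apply, hs]

lemma sum {ι : Type*} [Fintype ι] {f : ι → S × Ω → E} {η : ι → Ω → Lp E p μ}
    (hf : ∀ j, IsJointRepresentative P (f j) (η j)) :
    IsJointRepresentative P (fun z => ∑ j, f j z) (fun ω => ∑ j, η j ω) where
  stronglyMeasurable :=
    Finset.stronglyMeasurable_fun_sum _ fun j _ => (hf j).stronglyMeasurable
  ae_eq := by
    filter_upwards [ae_all_iff.2 fun j => (hf j).ae_eq] with ω hω
    filter_upwards [Lp.coeFn_finsetSum Finset.univ fun j => η j ω, ae_all_iff.2 hω] with s hsum hs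
    simp only [hsum, Finset.sum_apply, hs]

lemma ae_enorm_eq (hf : IsJointRepresentative P f η) :
    ∀ᵐ ω ∂P, ‖η ω‖ₑ = eLpNorm (fun s => f (s, ω)) p μ := by
  filter_upwards [hf.ae_eq] with ω hω
  rw [Lp.enorm_def, eLpNorm_congr_ae hω]

lemma eLpNorm_le [SFinite μ] [SigmaFinite P] (hf : IsJointRepresentative P f η) (hpq : p ≤ q)
    (hq : q ≠ ∞) : eLpNorm η q P ≤ eLpNorm (fun s => eLpNorm (fun ω => f (s, ω)) q P) p μ :=
  (eLpNorm_congr_enorm_ae hf.ae_enorm_eq).trans_le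
    (eLpNorm_eLpNorm_le hpq hq hf.stronglyMeasurable)

end IsJointRepresentative

section Symmetrization

variable {Ω E ι : Type*} {mΩ : MeasurableSpace Ω} {P : Measure Ω}
  [NormedAddCommGroup E] [NormedSpace ℝ E] [CompleteSpace E] {q : ℝ≥0∞}

lemma eLpNorm_le_eLpNorm_add_of_indep [IsFiniteMeasure P] {m₁ m₂ : MeasurableSpace Ω}
    (hm₁ : m₁ ≤ mΩ) (hm₂ : m₂ ≤ mΩ) (hindep : Indep m₁ m₂ P)
    (hq : 1 ≤ q) {X Y : Ω → E} (hX : StronglyMeasurable[m₁] X) (hY : StronglyMeasurable[m₂] Y)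
    (hXint : Integrable X P) (hYint : Integrable Y P) (hYmean : ∫ ω, Y ω ∂P = 0) :
    eLpNorm X q P ≤ eLpNorm (X + Y) q P := by
  have hcond : P[X + Y|m₁] =ᵐ[P] X := by
    filter_upwards [condExp_add hXint hYint m₁, condExp_indep_eq hm₂ hm₁ hY hindep.symm]
      with ω hadd hzero
    rw [hadd, Pi.add_apply, hzero, hYmean, condExp_of_stronglyMeasurable hm₁ hX hXint, add_zero]
  rw [← eLpNorm_congr_ae hcond]
  exact eLpNorm_condExp_le_eLpNorm _ hq

variable [MeasurableSpace E] [BorelSpace E] {X : ι → Ω → E}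

lemma eLpNorm_sum_le_eLpNorm_sum_of_subset [IsFiniteMeasure P] (hq : 1 ≤ q)
    (hX : ∀ j, Integrable (X j) P) (hindep : iIndepFun X P) (hmean : ∀ j, ∫ ω, X j ω ∂P = 0)
    {A B : Finset ι} (hAB : A ⊆ B) :
    eLpNorm (fun ω => ∑ j ∈ A, X j ω) q P ≤ eLpNorm (fun ω => ∑ j ∈ B, X j ω) q P := by
  classical
  wlog hmeas : ∀ j, StronglyMeasurable (X j) generalizing X
  · have hmk (j : ι) := (hX j).aestronglyMeasurable.ae_eq_mk
    have hsum (C : Finset ι) : (fun ω => ∑ j ∈ C, X j ω) =ᵐ[P]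
        fun ω => ∑ j ∈ C, (hX j).aestronglyMeasurable.mk (X j) ω := by
      filter_upwards [(Finset.eventually_all C).2 fun j _ => hmk j] with ω hω
      exact Finset.sum_congr rfl hω
    rw [eLpNorm_congr_ae (hsum A), eLpNorm_congr_ae (hsum B)]
    exact this (fun j => (hX j).congr (hmk j)) (hindep.congr hmk)
      (fun j => (integral_congr_ae (hmk j)).symm.trans (hmean j))
      fun j => (hX j).aestronglyMeasurable.stronglyMeasurable_mk
  let m : ι → MeasurableSpace Ω := fun j => MeasurableSpace.comap (X j) ‹_›
  have hm (j : ι) : m j ≤ mΩ := (hmeas j).measurable.comap_le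
  have hXm (C : Finset ι) : StronglyMeasurable[⨆ j ∈ (C : Set ι), m j] fun ω => ∑ j ∈ C, X j ω :=
    Finset.stronglyMeasurable_fun_sum _ fun j hj =>
      StronglyMeasurable.mono (stronglyMeasurable_iff_measurable_separable.2
        ⟨comap_measurable (X j), (hmeas j).isSeparable_range⟩) (le_iSup₂_of_le j hj le_rfl)
  have hsplit : (fun ω => ∑ j ∈ B, X j ω) =
      (fun ω => ∑ j ∈ A, X j ω) + fun ω => ∑ j ∈ B \ A, X j ω := by
    ext ω
    rw [Pi.add_apply, add_comm, Finset.sum_sdiff hAB]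
  rw [hsplit]
  refine eLpNorm_le_eLpNorm_add_of_indep (iSup₂_le fun j _ => hm j) (iSup₂_le fun j _ => hm j)
    (indep_iSup_of_disjoint hm hindep.iIndep
      (Finset.disjoint_coe.2 Finset.disjoint_sdiff)) hq (hXm A) (hXm (B \ A))
    (integrable_finsetSum _ fun j _ => hX j) (integrable_finsetSum _ fun j _ => hX j) ?_
  rw [integral_finsetSum _ fun j _ => hX j]
  exact Finset.sum_eq_zero fun j _ => hmean j

lemma eLpNorm_sum_le_two_mul_eLpNorm_sum_sign_smul [IsFiniteMeasure P] [Fintype ι] (hq : 1 ≤ q)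
    (hX : ∀ j, Integrable (X j) P) (hindep : iIndepFun X P) (hmean : ∀ j, ∫ ω, X j ω ∂P = 0)
    {ε : ι → ℝ} (hε : ∀ j, ε j = -1 ∨ ε j = 1) :
    eLpNorm (fun ω => ∑ j, X j ω) q P ≤ 2 * eLpNorm (fun ω => ∑ j, ε j • X j ω) q P := by
  classical
  have hpart (A : Finset ι) (c : ℝ) (hc : ‖c‖ₑ = 1) (hA : ∀ j ∈ A, ε j = c) :
      eLpNorm (fun ω => ∑ j ∈ A, X j ω) q P ≤ eLpNorm (fun ω => ∑ j, ε j • X j ω) q P := by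
    have hsmul : (fun ω => ∑ j ∈ A, ε j • X j ω) = c • fun ω => ∑ j ∈ A, X j ω := by
      ext ω
      rw [Pi.smul_apply, Finset.smul_sum]
      exact Finset.sum_congr rfl fun j hj => by rw [hA j hj]
    calc eLpNorm (fun ω => ∑ j ∈ A, X j ω) q P
        = eLpNorm (fun ω => ∑ j ∈ A, ε j • X j ω) q P := by
          rw [hsmul, eLpNorm_const_smul, hc, one_mul]
      _ ≤ _ := eLpNorm_sum_le_eLpNorm_sum_of_subset hq (fun j => (hX j).smul (ε j))
          (hindep.comp (fun j x => ε j • x) fun j => measurable_const_smul (ε j))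
          (fun j => (integral_smul (ε j) (X j)).trans (by rw [hmean j, smul_zero]))
          (Finset.subset_univ A)
  set A : Finset ι := {j | ε j = 1} with hA
  have hsplit : (fun ω => ∑ j, X j ω) =
      (fun ω => ∑ j ∈ A, X j ω) + fun ω => ∑ j ∈ Aᶜ, X j ω := by
    ext ω
    exact (Finset.sum_add_sum_compl A _).symm
  rw [hsplit, two_mul]
  refine (eLpNorm_add_le ?_ ?_ hq).trans
    (add_le_add (hpart A 1 (by simp) fun j hj => by simpa [hA] using hj)
      (hpart Aᶜ (-1) (by simp) fun j hj => (hε j).resolve_right (by simpa [hA] using hj)))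
  all_goals exact (integrable_finsetSum _ fun j _ => hX j).aestronglyMeasurable

lemma eLpNorm_sum_le_two_mul_eLpNorm_sum_smul_prod [IsFiniteMeasure P] [Fintype ι] (hq : 1 ≤ q)
    (hq_top : q ≠ ∞) (hX : ∀ j, Integrable (X j) P) (hindep : iIndepFun X P)
    (hmean : ∀ j, ∫ ω, X j ω ∂P = 0) {Ω' : Type*} [MeasurableSpace Ω'] {ν : Measure Ω'}
    [IsProbabilityMeasure ν] {r : ι → Ω' → ℝ} (hr : ∀ j, Measurable (r j))
    (hr_mem : ∀ j ω', r j ω' = -1 ∨ r j ω' = 1) :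
    eLpNorm (fun ω => ∑ j, X j ω) q P ≤
      2 * eLpNorm (fun z : Ω' × Ω => ∑ j, r j z.1 • X j z.2) q (ν.prod P) := by
  have hmeas : AEStronglyMeasurable (fun z : Ω' × Ω => ∑ j, r j z.1 • X j z.2) (ν.prod P) :=
    Finset.aestronglyMeasurable_fun_sum _ fun j _ =>
      ((hr j).comp measurable_fst).aestronglyMeasurable.smul (hX j).aestronglyMeasurable.comp_snd
  rw [mul_comm, ← ENNReal.div_le_iff two_ne_zero ENNReal.ofNat_ne_top, eLpNorm_prod hq_top hmeas]
  calc eLpNorm (fun ω => ∑ j, X j ω) q P / 2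
      = eLpNorm (fun _ : Ω' => eLpNorm (fun ω => ∑ j, X j ω) q P / 2) q ν := by
        rw [eLpNorm_const _ (one_pos.trans_le hq).ne' (IsProbabilityMeasure.ne_zero ν)]
        simp
    _ ≤ _ := eLpNorm_mono_enorm fun ω' => ENNReal.div_le_of_le_mul' <|
        eLpNorm_sum_le_two_mul_eLpNorm_sum_sign_smul hq hX hindep hmean fun j => hr_mem j ω'

end Symmetrization

section Khintchine

variable {Ω : Type*} [MeasurableSpace Ω] {P : Measure Ω}

lemma lintegral_enorm_pow_le_of_hasSubgaussianMGF_one {X : Ω → ℝ} (hX : HasSubgaussianMGF X 1 P)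
    (k : ℕ) :
    ∫⁻ ω, ‖X ω‖ₑ ^ k ∂P ≤ ENNReal.ofReal (k.factorial * (2 * Real.exp (1 / 2))) := by
  have hpow (x : ℝ) : |x| ^ k ≤ k.factorial * (Real.exp (1 * x) + Real.exp (-1 * x)) := by
    have h := (div_le_iff₀' (by positivity)).1
      (Real.pow_div_factorial_le_exp |x| (abs_nonneg x) k)
    rw [one_mul, neg_one_mul]
    exact h.trans (by gcongr; exact Real.exp_abs_le x)
  have hint (t : ℝ) : Integrable (fun ω => Real.exp (t * X ω)) P := hX.integrable_exp_mul t
  calc ∫⁻ ω, ‖X ω‖ₑ ^ k ∂P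
      ≤ ∫⁻ ω, ENNReal.ofReal (k.factorial * (Real.exp (1 * X ω) + Real.exp (-1 * X ω))) ∂P := by
        refine lintegral_mono fun ω => ?_
        rw [Real.enorm_eq_ofReal_abs, ← ENNReal.ofReal_pow (abs_nonneg _)]
        exact ENNReal.ofReal_le_ofReal (hpow _)
    _ = ENNReal.ofReal (k.factorial * (mgf X P 1 + mgf X P (-1))) := by
        rw [mgf, mgf, ← integral_add (hint 1) (hint (-1)), ← integral_const_mul]
        exact (ofReal_integral_eq_lintegral_ofReal
          (((hint 1).add (hint (-1))).const_mul (k.factorial : ℝ))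
          (ae_of_all _ fun ω => mul_nonneg (Nat.cast_nonneg _)
            (add_nonneg (Real.exp_nonneg _) (Real.exp_nonneg _)))).symm
    _ ≤ ENNReal.ofReal (k.factorial * (2 * Real.exp (1 / 2))) := by
        rw [two_mul]
        gcongr
        exacts [(hX.mgf_le 1).trans_eq (by norm_num), (hX.mgf_le (-1)).trans_eq (by norm_num)]

lemma eLpNorm_natCast_le_of_hasSubgaussianMGF_one {X : Ω → ℝ} (hX : HasSubgaussianMGF X 1 P)
    {k : ℕ} (hk : k ≠ 0) :
    eLpNorm X k P ≤ ENNReal.ofReal (k.factorial * (2 * Real.exp (1 / 2))) := by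
  have hconst_one : 1 ≤ k.factorial * (2 * Real.exp (1 / 2)) := by
    have hfact : (1 : ℝ) ≤ k.factorial := by exact_mod_cast k.factorial_pos
    have hexp : (1 : ℝ) ≤ Real.exp (1 / 2) := Real.one_le_exp (by norm_num)
    nlinarith
  calc eLpNorm X k P = (∫⁻ ω, ‖X ω‖ₑ ^ k ∂P) ^ (k : ℝ)⁻¹ := by
        simp [eLpNorm_eq_lintegral_rpow_enorm_toReal (Nat.cast_ne_zero.2 hk)
          (ENNReal.natCast_ne_top k)]
    _ ≤ ENNReal.ofReal (k.factorial * (2 * Real.exp (1 / 2))) ^ (k : ℝ)⁻¹ := by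
        gcongr
        exact lintegral_enorm_pow_le_of_hasSubgaussianMGF_one hX k
    _ ≤ ENNReal.ofReal (k.factorial * (2 * Real.exp (1 / 2))) ^ (1 : ℝ) :=
        ENNReal.rpow_le_rpow_of_exponent_le (ENNReal.one_le_ofReal.2 hconst_one)
          (Nat.cast_inv_le_one k)
    _ = ENNReal.ofReal (k.factorial * (2 * Real.exp (1 / 2))) := ENNReal.rpow_one _

lemma eLpNorm_natCast_le_of_hasSubgaussianMGF {X : Ω → ℝ} {c : NNReal}
    (hX : HasSubgaussianMGF X c P) {k : ℕ} (hk : k ≠ 0) :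
    eLpNorm X k P ≤ ENNReal.ofReal (k.factorial * (2 * Real.exp (1 / 2)) * √c) := by
  rcases eq_or_ne c 0 with rfl | hc
  · rw [eLpNorm_congr_ae hX.ae_eq_zero_of_hasSubgaussianMGF_zero, eLpNorm_zero]
    exact zero_le
  have hσ : 0 < √(c : ℝ) := by positivity
  have hscaled : HasSubgaussianMGF (fun ω => (√c)⁻¹ * X ω) 1 P := by
    convert hX.const_mul (√c)⁻¹
    refine NNReal.coe_injective ?_
    change 1 = (√(c : ℝ))⁻¹ ^ 2 * (c : ℝ)
    rw [inv_pow, Real.sq_sqrt c.coe_nonneg, inv_mul_cancel₀ (NNReal.coe_ne_zero.2 hc)]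
  have hX_eq : X = √(c : ℝ) • fun ω => (√c)⁻¹ * X ω := by
    ext ω
    rw [Pi.smul_apply, smul_eq_mul, mul_inv_cancel_left₀ hσ.ne']
  rw [hX_eq, eLpNorm_const_smul, mul_comm, ENNReal.ofReal_mul (by positivity),
    Real.enorm_of_nonneg hσ.le]
  gcongr
  exact eLpNorm_natCast_le_of_hasSubgaussianMGF_one hscaled hk

lemma exists_isRademacherFamily :
    ∃ (Ω : Type) (_ : MeasurableSpace Ω) (P : Measure Ω) (r : ℕ → Ω → ℝ),
      IsProbabilityMeasure P ∧ IsRademacherFamily P r := by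
  obtain ⟨Ω, _, P, X, hX, hlaw, hindep, hP⟩ :=
    exists_iid ℕ (PMF.uniformOfFintype Bool).toMeasure
  have hprob (j : ℕ) (b : Bool) : P {ω | X j ω = b} = 1 / 2 := by
    change P (X j ⁻¹' {b}) = 1 / 2
    rw [← Measure.map_apply (hX j) (measurableSet_singleton b), (hlaw j).map_eq,
      PMF.toMeasure_apply_singleton _ _ (measurableSet_singleton b)]
    simp
  have hsign : Measurable fun b : Bool => if b then (1 : ℝ) else -1 := measurable_of_countable _
  refine ⟨Ω, _, P, fun j ω => if X j ω then 1 else -1, hP, fun j => hsign.comp (hX j),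
    fun j ω => ?_, hindep.comp _ fun _ => hsign, fun j => ?_, fun j => ?_⟩
  · cases X j ω <;> simp
  · rw [← hprob j false]
    congr! 3 with ω
    cases X j ω <;> norm_num
  · rw [← hprob j true]
    congr! 3 with ω
    cases X j ω <;> norm_num

namespace IsRademacherFamily

variable {r : ℕ → Ω → ℝ}

lemma integral_eq_zero [IsProbabilityMeasure P] (hr : IsRademacherFamily P r) (j : ℕ) :
    ∫ ω, r j ω ∂P = 0 := by
  have hone : MeasurableSet {ω | r j ω = 1} := hr.measurable j (measurableSet_singleton 1)
  have hdecomp : r j = fun ω => {ω | r j ω = 1}.indicator (fun _ => (2 : ℝ)) ω - 1 := by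
    ext ω
    rcases hr.mem j ω with h | h <;> norm_num [Set.indicator, h]
  rw [hdecomp, integral_sub ((integrable_const _).indicator hone) (integrable_const _),
    integral_indicator_const _ hone, Measure.real, hr.prob_one]
  simp

lemma hasSubgaussianMGF_sum [IsProbabilityMeasure P] (hr : IsRademacherFamily P r)
    (s : Finset ℕ) (a : ℕ → ℝ) :
    HasSubgaussianMGF (fun ω => ∑ j ∈ s, r j ω * a j) (∑ j ∈ s, ‖a j‖₊ ^ 2) P := by
  have hsign (j : ℕ) : HasSubgaussianMGF (r j) 1 P := by
    convert hasSubgaussianMGF_of_mem_Icc_of_integral_eq_zero (a := -1) (b := 1)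
      (hr.measurable j).aemeasurable
      (ae_of_all P fun ω => by rcases hr.mem j ω with h | h <;> norm_num [h])
      (hr.integral_eq_zero j)
    ext
    norm_num
  refine HasSubgaussianMGF.sum_of_iIndepFun
    (hr.indep.comp (fun j x => x * a j) fun j => by fun_prop) fun j _ => ?_
  convert (hsign j).const_mul (a j) using 1
  · ext ω
    exact mul_comm _ _
  · refine NNReal.coe_injective ?_
    change ‖a j‖ ^ 2 = a j ^ 2 * 1
    rw [mul_one, Real.norm_eq_abs, sq_abs]

lemma eLpNorm_sum_natCast_le [IsProbabilityMeasure P] (hr : IsRademacherFamily P r) {k : ℕ}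
    (hk : k ≠ 0) (s : Finset ℕ) (a : ℕ → ℝ) :
    eLpNorm (fun ω => ∑ j ∈ s, r j ω * a j) k P ≤
      ENNReal.ofReal (k.factorial * (2 * Real.exp (1 / 2)) * √(∑ j ∈ s, a j ^ 2)) := by
  simpa using eLpNorm_natCast_le_of_hasSubgaussianMGF (hr.hasSubgaussianMGF_sum s a) hk

end IsRademacherFamily

lemma khintchineConst_nonneg (q : ℝ≥0∞) : 0 ≤ khintchineConst q :=
  Real.sInf_nonneg fun _ hB => hB.1.le

namespace IsRademacherFamily

variable {Ω' : Type} [MeasurableSpace Ω'] {ν : Measure Ω'} [IsProbabilityMeasure ν]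
  {r : ℕ → Ω' → ℝ} {q : ℝ≥0∞}

lemma eLpNorm_sum_le (hr : IsRademacherFamily ν r) (hq : q ≠ ∞) {n : ℕ} (a : Fin n → ℝ) :
    eLpNorm (fun ω => ∑ j : Fin n, r j ω * a j) q ν ≤
      ENNReal.ofReal (khintchineConst q * √(∑ j, a j ^ 2)) := by
  obtain ⟨k, hqk⟩ := ENNReal.exists_nat_gt hq
  have hk : k ≠ 0 := by
    rintro rfl
    simp at hqk
  -- Any admissible constant will do: it only rules out `sInf ∅ = 0` in `khintchineConst`.
  have hadm : khintchineConst q ∈ closure _ :=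
    csInf_mem_closure ⟨k.factorial * (2 * Real.exp (1 / 2)), by positivity,
      fun Ω _ P _ ρ hρ m b => (eLpNorm_le_eLpNorm_of_exponent_le hqk.le
        (hρ.hasSubgaussianMGF_sum _ b).aestronglyMeasurable).trans
          (hρ.eLpNorm_sum_natCast_le hk _ b)⟩ ⟨0, fun _ hB => hB.1.le⟩
  refine closure_minimal (fun B hB => ?_) (isClosed_le continuous_const
    (ENNReal.continuous_ofReal.comp (continuous_mul_const √(∑ j, a j ^ 2)))) hadm
  simpa [Finset.sum_range] using
    hB.2 Ω' ν r hr n fun j => if h : j < n then a ⟨j, h⟩ else 0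

lemma eLpNorm_sum_smul_prod_le (hr : IsRademacherFamily ν r) (hq : q ≠ ∞) [SFinite P] {n : ℕ}
    {X : Fin n → Ω → ℝ} (hX : ∀ j, AEStronglyMeasurable (X j) P) :
    eLpNorm (fun z : Ω' × Ω => ∑ j : Fin n, r j z.1 • X j z.2) q (ν.prod P) ≤
      ENNReal.ofReal (khintchineConst q) * eLpNorm (fun ω => √(∑ j, X j ω ^ 2)) q P := by
  have hmeas : AEStronglyMeasurable (fun z : Ω' × Ω => ∑ j : Fin n, r j z.1 • X j z.2) (ν.prod P) :=
    Finset.aestronglyMeasurable_fun_sum _ fun j _ =>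
      ((hr.measurable j).comp measurable_fst).aestronglyMeasurable.smul (hX j).comp_snd
  rw [eLpNorm_prod_symm hq hmeas, ← Real.enorm_of_nonneg (khintchineConst_nonneg q),
    ← eLpNorm_const_smul]
  refine eLpNorm_mono_enorm fun ω => ?_
  rw [enorm_eq_self, Pi.smul_apply, smul_eq_mul, Real.enorm_of_nonneg
    (mul_nonneg (khintchineConst_nonneg q) (Real.sqrt_nonneg _))]
  exact hr.eLpNorm_sum_le hq fun j => X j ω

end IsRademacherFamily

end Khintchine

section SquareFunction

variable {ι : Type*} [Fintype ι] {s : ℝ}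

lemma enorm_sqrt_sum_sq_le (hs : 0 < s) (hs_two : s ≤ 2) (x : ι → ℝ) :
    ‖√(∑ j, x j ^ 2)‖ₑ ≤ (∑ j, ‖x j‖ₑ ^ s) ^ s⁻¹ := by
  rw [ENNReal.le_rpow_inv_iff hs]
  calc ‖√(∑ j, x j ^ 2)‖ₑ ^ s = (∑ j, ‖x j‖ₑ ^ 2) ^ (s / 2) := by
        rw [Real.enorm_of_nonneg (Real.sqrt_nonneg _), Real.sqrt_eq_rpow,
          ← ENNReal.ofReal_rpow_of_nonneg (Finset.sum_nonneg fun j _ => sq_nonneg (x j))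
            one_half_pos.le, ← ENNReal.rpow_mul, one_div_mul_eq_div,
          ENNReal.ofReal_sum_of_nonneg fun j _ => sq_nonneg (x j)]
        simp only [← enorm_pow, Real.enorm_of_nonneg (sq_nonneg _)]
    _ ≤ ∑ j, (‖x j‖ₑ ^ 2) ^ (s / 2) :=
        Finset.le_sum_of_subadditive (· ^ (s / 2)) (ENNReal.zero_rpow_of_pos (half_pos hs)).le
          (fun a b => ENNReal.rpow_add_le_add_rpow a b (half_pos hs).le (by linarith)) _ _
    _ = ∑ j, ‖x j‖ₑ ^ s := by
        simp only [← ENNReal.rpow_two, ← ENNReal.rpow_mul, mul_div_cancel₀ s (two_ne_zero' ℝ)]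

lemma eLpNorm_sqrt_sum_sq_le {Ω : Type*} [MeasurableSpace Ω] {P : Measure Ω} (hs : 0 < s)
    (hs_two : s ≤ 2) {q : ℝ≥0∞} (hsq : ENNReal.ofReal s ≤ q) {X : ι → Ω → ℝ}
    (hX : ∀ j, AEStronglyMeasurable (X j) P) :
    eLpNorm (fun ω => √(∑ j, X j ω ^ 2)) q P ≤ (∑ j, eLpNorm (X j) q P ^ s) ^ s⁻¹ := by
  have hexp : q * ENNReal.ofReal s⁻¹ * ENNReal.ofReal s = q := by
    rw [mul_assoc, ← ENNReal.ofReal_mul (by positivity), inv_mul_cancel₀ hs.ne',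
      ENNReal.ofReal_one, mul_one]
  have hone : 1 ≤ q * ENNReal.ofReal s⁻¹ := by
    rwa [ENNReal.ofReal_inv_of_pos hs, ← div_eq_mul_inv,
      ENNReal.le_div_iff_mul_le (.inl (ENNReal.ofReal_pos.2 hs).ne') (.inl ENNReal.ofReal_ne_top),
      one_mul]
  calc eLpNorm (fun ω => √(∑ j, X j ω ^ 2)) q P
      ≤ eLpNorm (fun ω => ‖∑ j, ‖X j ω‖ₑ ^ s‖ₑ ^ s⁻¹) q P :=
        eLpNorm_mono_enorm fun ω => enorm_sqrt_sum_sq_le hs hs_two fun j => X j ω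
    _ = eLpNorm (∑ j, fun ω => ‖X j ω‖ₑ ^ s) (q * ENNReal.ofReal s⁻¹) P ^ s⁻¹ := by
        rw [eLpNorm_enorm_rpow _ (inv_pos.2 hs)]
        congr! with ω
        simp
    _ ≤ (∑ j, eLpNorm (fun ω => ‖X j ω‖ₑ ^ s) (q * ENNReal.ofReal s⁻¹) P) ^ s⁻¹ := by
        gcongr
        exact eLpNorm_sum_le (fun j _ => ((hX j).enorm.pow_const s).aestronglyMeasurable) hone
    _ = (∑ j, eLpNorm (X j) q P ^ s) ^ s⁻¹ := by
        simp only [eLpNorm_enorm_rpow _ hs, hexp]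

end SquareFunction

namespace IsJointRepresentative

variable {S Ω : Type*} [MeasurableSpace S] {μ : Measure S} [SFinite μ] [MeasurableSpace Ω]
  {P : Measure Ω} [IsProbabilityMeasure P] {p q : ℝ≥0∞} [Fact (1 ≤ p)]
  [MeasurableSpace (Lp ℝ p μ)] [BorelSpace (Lp ℝ p μ)] {n : ℕ} {η : Fin n → Ω → Lp ℝ p μ}
  {f : Fin n → S × Ω → ℝ}

theorem eLpNorm_sum_le_eLpNorm_sqrt_sum_sq (hf : ∀ j, IsJointRepresentative P (f j) (η j))
    (hpq : p ≤ q) (hq : q ≠ ∞) (hη : ∀ j, Integrable (η j) P) (hindep : iIndepFun η P)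
    (hmean : ∀ j, ∫ ω, η j ω ∂P = 0) :
    eLpNorm (fun ω => ∑ j, η j ω) q P ≤ 2 * (ENNReal.ofReal (khintchineConst q) *
      eLpNorm (fun s => eLpNorm (fun ω => √(∑ j, f j (s, ω) ^ 2)) q P) p μ) := by
  obtain ⟨Ω', _, ν, r, _, hr⟩ := exists_isRademacherFamily
  have hrep : IsJointRepresentative (ν.prod P) (fun z => ∑ j : Fin n, r j z.2.1 • f j (z.1, z.2.2))
      (fun z => ∑ j : Fin n, r j z.1 • η j z.2) :=
    .sum fun j => ((hf j).comp Measure.quasiMeasurePreserving_snd).smul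
      ((hr.measurable j).comp measurable_fst)
  have khintchine (s : S) :
      eLpNorm (fun z : Ω' × Ω => ∑ j : Fin n, r j z.1 • f j (s, z.2)) q (ν.prod P) ≤
        ENNReal.ofReal (khintchineConst q) * eLpNorm (fun ω => √(∑ j, f j (s, ω) ^ 2)) q P :=
    hr.eLpNorm_sum_smul_prod_le (X := fun j ω => f j (s, ω)) hq fun j =>
      ((hf j).stronglyMeasurable.comp_measurable measurable_prodMk_left).aestronglyMeasurable
  calc eLpNorm (fun ω => ∑ j, η j ω) q P
      ≤ 2 * eLpNorm (fun z : Ω' × Ω => ∑ j : Fin n, r j z.1 • η j z.2) q (ν.prod P) :=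
        eLpNorm_sum_le_two_mul_eLpNorm_sum_smul_prod ((Fact.out : 1 ≤ p).trans hpq) hq hη hindep
          hmean (fun j => hr.measurable j) fun j => hr.mem j
    _ ≤ 2 * eLpNorm (fun s => eLpNorm (fun z : Ω' × Ω => ∑ j : Fin n, r j z.1 • f j (s, z.2)) q
          (ν.prod P)) p μ := by
        gcongr
        exact hrep.eLpNorm_le hpq hq
    _ ≤ _ := by
        gcongr
        exact eLpNorm_le_mul_eLpNorm_of_ae_le_mul' (ae_of_all _ khintchine) p

end IsJointRepresentative

lemma measurable_eLpNorm_of_absolutelyContinuous {S E : Type*} [MeasurableSpace S]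
    {μ κ : Measure S} (hκ : κ ≪ μ) [NormedAddCommGroup E] (p q : ℝ≥0∞) [Fact (1 ≤ p)]
    [MeasurableSpace (Lp E p μ)] [BorelSpace (Lp E p μ)] :
    Measurable fun v : Lp E p μ => eLpNorm v q κ := by
  have hmeas (v : Lp E p μ) : AEStronglyMeasurable v κ := (Lp.aestronglyMeasurable v).mono_ac hκ
  refine (lowerSemicontinuous_iff_isClosed_preimage.2 fun y =>
    IsSeqClosed.isClosed fun u v hu huv => ?_).measurable
  obtain ⟨k, -, hk⟩ := (tendstoInMeasure_of_tendsto_Lp huv).exists_seq_tendsto_ae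
  exact (Lp.eLpNorm_lim_le_liminf_eLpNorm (fun m => hmeas (u (k m))) v
    (hκ.ae_le hk)).trans (liminf_le_of_le (by isBoundedDefault) fun b hb =>
      let ⟨m, hm⟩ := hb.exists; hm.trans (hu (k m)))

namespace IsJointRepresentative

variable {S Ω E : Type*} [MeasurableSpace S] {μ : Measure S} [MeasurableSpace Ω]
  {P : Measure Ω} [NormedAddCommGroup E] {p q : ℝ≥0∞}
  {f : S × Ω → E} {η : Ω → Lp E p μ}

lemma lintegral_eLpNorm_rpow [SFinite P] (hf : IsJointRepresentative P f η) (hq0 : q ≠ 0)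
    (hq : q ≠ ∞) {κ : Measure S} [SFinite κ] (hκ : κ ≪ μ) :
    ∫⁻ s, eLpNorm (fun ω => f (s, ω)) q P ^ q.toReal ∂κ =
      ∫⁻ ω, eLpNorm (η ω) q κ ^ q.toReal ∂P := by
  have hη : ∀ᵐ ω ∂P, eLpNorm (η ω) q κ = eLpNorm (fun s => f (s, ω)) q κ :=
    hf.ae_eq.mono fun ω hω => eLpNorm_congr_ae (hκ.ae_le hω)
  rw [lintegral_congr_ae (hη.mono fun ω hω => congrArg (· ^ q.toReal) hω)]
  simp only [eLpNorm_rpow_toReal hq0 hq]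
  exact lintegral_lintegral_swap (f := fun s ω => ‖f (s, ω)‖ₑ ^ q.toReal)
    (hf.stronglyMeasurable.enorm.pow_const _).aemeasurable

theorem ae_eLpNorm_eq_of_identDistrib [SigmaFinite μ] [SFinite P] [Fact (1 ≤ p)]
    [MeasurableSpace (Lp E p μ)] [BorelSpace (Lp E p μ)] (hf : IsJointRepresentative P f η)
    {Ω' : Type*} [MeasurableSpace Ω'] {P' : Measure Ω'} [SFinite P'] {f' : S × Ω' → E}
    {η' : Ω' → Lp E p μ} (hf' : IsJointRepresentative P' f' η') (hη : IdentDistrib η η' P P')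
    (hq : q ≠ ∞) :
    ∀ᵐ s ∂μ, eLpNorm (fun ω => f (s, ω)) q P = eLpNorm (fun ω => f' (s, ω)) q P' := by
  rcases eq_or_ne q 0 with rfl | hq0
  · simp
  have hfub := ae_eq_of_forall_setLIntegral_eq_of_sigmaFinite (μ := μ)
    ((measurable_eLpNorm_prodMk_left (ν := P) hf.stronglyMeasurable hq).pow_const q.toReal)
    ((measurable_eLpNorm_prodMk_left (ν := P') hf'.stronglyMeasurable hq).pow_const q.toReal)
    fun A _ _ => ?_
  · filter_upwards [hfub] with s hs
    exact ENNReal.rpow_left_injective (ENNReal.toReal_pos hq0 hq).ne' hs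
  have hA : μ.restrict A ≪ μ := Measure.absolutelyContinuous_restrict
  rw [hf.lintegral_eLpNorm_rpow hq0 hq hA, hf'.lintegral_eLpNorm_rpow hq0 hq hA]
  exact (hη.comp ((measurable_eLpNorm_of_absolutelyContinuous hA p q).pow_const _)).lintegral_eq

end IsJointRepresentative

theorem IsJointRepresentative.eLpNorm_sum_le_of_identDistrib {S Ω : Type*} [MeasurableSpace S]
    {μ : Measure S} [SigmaFinite μ] [MeasurableSpace Ω] {P : Measure Ω} [IsProbabilityMeasure P]
    {p q : ℝ≥0∞} [Fact (1 ≤ p)] [MeasurableSpace (Lp ℝ p μ)] [BorelSpace (Lp ℝ p μ)] {n : ℕ}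
    {η : Fin n → Ω → Lp ℝ p μ} {f : Fin n → S × Ω → ℝ}
    (hf : ∀ j, IsJointRepresentative P (f j) (η j)) (hpq : p ≤ q) (hq : q ≠ ∞)
    {t : ℝ} (ht : 0 < t) (ht_two : t ≤ 2) (htq : ENNReal.ofReal t ≤ q)
    {i : Fin n} (hη : Integrable (η i) P) (hindep : iIndepFun η P)
    (hident : ∀ j, IdentDistrib (η j) (η i) P P) (hmean : ∫ ω, η i ω ∂P = 0) :
    eLpNorm (fun ω => ∑ j, η j ω) q P ≤ ENNReal.ofReal (2 * khintchineConst q) *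
      ((n : ℝ≥0∞) ^ t⁻¹ * eLpNorm (fun s => eLpNorm (fun ω => f i (s, ω)) q P) p μ) := by
  have hlaw : ∀ᵐ s ∂μ, ∀ j,
      eLpNorm (fun ω => f j (s, ω)) q P = eLpNorm (fun ω => f i (s, ω)) q P :=
    ae_all_iff.2 fun j => (hf j).ae_eLpNorm_eq_of_identDistrib (hf i) (hident j) hq
  have hsquare : ∀ᵐ s ∂μ, eLpNorm (fun ω => √(∑ j, f j (s, ω) ^ 2)) q P ≤
      (n : ℝ≥0∞) ^ t⁻¹ * eLpNorm (fun ω => f i (s, ω)) q P := by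
    filter_upwards [hlaw] with s hs
    refine (eLpNorm_sqrt_sum_sq_le ht ht_two htq (X := fun j ω => f j (s, ω)) fun j =>
      ((hf j).stronglyMeasurable.comp_measurable
        measurable_prodMk_left).aestronglyMeasurable).trans_eq ?_
    simp only [hs, Finset.sum_const, Finset.card_univ, Fintype.card_fin, nsmul_eq_mul]
    rw [ENNReal.mul_rpow_of_nonneg _ _ (inv_nonneg.2 ht.le), ENNReal.rpow_rpow_inv ht.ne']
  rw [ENNReal.ofReal_mul zero_le_two, ENNReal.ofReal_ofNat, mul_assoc]
  refine (eLpNorm_sum_le_eLpNorm_sqrt_sum_sq hf hpq hq (fun j => (hident j).symm.integrable_snd hη)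
    hindep fun j => (hident j).integral_eq.trans hmean).trans ?_
  gcongr
  exact eLpNorm_le_mul_eLpNorm_of_ae_le_mul'' p
    (measurable_eLpNorm_prodMk_left (hf i).stronglyMeasurable hq).aestronglyMeasurable hsquare

lemma HaveCommonRepresentative.exists_isJointRepresentative {S Ω : Type*} [MeasurableSpace S]
    {μ : Measure S} [MeasurableSpace Ω] {P : Measure Ω} {p q : ℝ≥0∞} {η : Ω → Lp ℝ p μ}
    {F : S → Lp ℝ q P} (h : HaveCommonRepresentative η F) :
    ∃ f, IsJointRepresentative P f η ∧ ∀ᵐ s ∂μ, ‖F s‖ₑ = eLpNorm (fun ω => f (s, ω)) q P := by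
  obtain ⟨f, hf, hfη, hfF⟩ := h
  exact ⟨f, ⟨hf.stronglyMeasurable, hfη⟩, hfF.mono fun s hs =>
    (Lp.enorm_def _).trans (eLpNorm_congr_ae hs)⟩

lemma enorm_inv_natCast_mul_ofReal_mul_rpow {n : ℕ} (hn : n ≠ 0) (c t : ℝ) :
    ‖(n : ℝ)⁻¹‖ₑ * (ENNReal.ofReal c * (n : ℝ≥0∞) ^ t) =
      ENNReal.ofReal (c * (n : ℝ) ^ (-(1 - t))) := by
  have hn_pos : (0 : ℝ) < n := by positivity
  rw [Real.enorm_of_nonneg (by positivity), ← ENNReal.ofReal_natCast,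
    ENNReal.ofReal_rpow_of_pos hn_pos, ← ENNReal.ofReal_mul' (by positivity),
    ← ENNReal.ofReal_mul (by positivity), neg_sub, Real.rpow_sub hn_pos, Real.rpow_one]
  congr 1
  field_simp

theorem mainTheorem1_general {S Ω : Type*} [MeasurableSpace S] (μ : Measure S) [SigmaFinite μ]
    [MeasurableSpace Ω] (P : Measure Ω) [IsProbabilityMeasure P]
    (p q : ℝ≥0∞) [Fact (1 ≤ p)] [Fact (1 ≤ q)] (hpq : p ≤ q) (hq : q ≠ ∞)
    [MeasurableSpace (Lp ℝ p μ)] [BorelSpace (Lp ℝ p μ)]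
    (M : ℕ) [NeZero M]
    (η : Fin M → Ω → Lp ℝ p μ) (F : Fin M → S → Lp ℝ q P)
    (hη : ∀ j, MemLp (η j) q P)
    (hηF : ∀ j, HaveCommonRepresentative (η j) (F j))
    (hindep : iIndepFun η P) (hident : ∀ i j, IdentDistrib (η i) (η j) P P)
    (hmean : ∫ ω, η 0 ω ∂P = 0) :
    eLpNorm (fun ω => (M : ℝ)⁻¹ • ∑ j, η j ω) q P ≤
      ENNReal.ofReal (2 * khintchineConst q * (M : ℝ) ^ (-(1 - 1 / (min q 2).toReal))) *
        eLpNorm (F 0) p μ := by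
  have hq_one : 1 ≤ q := Fact.out
  choose f hf hfF using fun j => (hηF j).exists_isJointRepresentative
  have hmin : min q 2 ≠ ∞ := ne_top_of_le_ne_top hq (min_le_left _ _)
  have hF : eLpNorm (F 0) p μ = eLpNorm (fun s => eLpNorm (fun ω => f 0 (s, ω)) q P) p μ :=
    eLpNorm_congr_enorm_ae (hfF 0)
  have hsum := IsJointRepresentative.eLpNorm_sum_le_of_identDistrib hf hpq hq
    (t := (min q 2).toReal)
    (ENNReal.toReal_pos (lt_min (one_pos.trans_le hq_one) two_pos).ne' hmin)
    (ENNReal.toReal_le_of_le_ofReal zero_le_two (by simp))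
    (by rw [ENNReal.ofReal_toReal hmin]; exact min_le_left _ _)
    ((hη 0).integrable hq_one) hindep (hident · 0) hmean
  calc eLpNorm (fun ω => (M : ℝ)⁻¹ • ∑ j, η j ω) q P
      = ‖(M : ℝ)⁻¹‖ₑ * eLpNorm (fun ω => ∑ j, η j ω) q P :=
        eLpNorm_const_smul (M : ℝ)⁻¹ (fun ω => ∑ j, η j ω) q P
    _ ≤ _ := by
      rw [← enorm_inv_natCast_mul_ofReal_mul_rpow (NeZero.ne M), one_div,
        hF, mul_assoc, mul_assoc]
      gcongr

theorem mainTheorem1 {S : Type u} [MeasurableSpace S] (μ : Measure S) [SigmaFinite μ]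
    (hμ : ApproximationByAveraging.{u, v} μ)
    {Ω : Type v} [MeasurableSpace Ω] (P : Measure Ω) [IsProbabilityMeasure P]
    (p q : ℝ≥0∞) [Fact (1 ≤ p)] [Fact (1 ≤ q)] (hpq : p ≤ q) (hq : q ≠ ∞)
    [MeasurableSpace (Lp ℝ p μ)] [BorelSpace (Lp ℝ p μ)]
    (M : ℕ) [NeZero M]
    (η : Fin M → Ω → Lp ℝ p μ) (F : Fin M → S → Lp ℝ q P)
    (hη : ∀ j, MemLp (η j) q P) (hF : ∀ j, MemLp (F j) p μ)
    (hηF : ∀ j, HaveCommonRepresentative (η j) (F j))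
    (hindep : iIndepFun η P) (hident : ∀ i j, IdentDistrib (η i) (η j) P P)
    (hmean : ∫ ω, η 0 ω ∂P = 0) :
    eLpNorm (fun ω => (M : ℝ)⁻¹ • ∑ j, η j ω) q P ≤
      ENNReal.ofReal (2 * khintchineConst q * (M : ℝ) ^ (-(1 - 1 / (min q 2).toReal))) *
        eLpNorm (F 0) p μ :=
  mainTheorem1_general μ P p q hpq hq M η F hη hηF hindep hident hmean
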